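/- Let $X_1,X_2,\dots$ be independent, identically distributed real random variables with a probability density $f$, distribution function $F$ and finite variance; put $\bar F=1-F$. The distribution functions of the 2nd upper 2-record value $U_{2,2}$ and of the 2nd lower 2-record value $L_{2,2}$ of this population are $$F_{U_{2,2}}(x)=1-\bar F(x)^2\,(1-2\log\bar F(x)),\qquad F_{L_{2,2}}(x)=F(x)^2\,(1-2\log F(x))$$ (with $0^2\log 0=0$). Let $S_X=\{x\in\mathbb R:0<F(x)<1\}$ be the support interval, which is also the support interval of $U_{2,2}$ and of $L_{2,2}$. The cumulative residual extropy of $U_{2,2}$, the cumulative past extropy of $L_{2,2}$, and their difference are $$\xi J(U_{2,2})=-\frac12\int_{S_X}\bigl(1-F_{U_{2,2}}(x)\bigr)^2dx,\qquad \bar\xi J(L_{2,2})=-\frac12\int_{S_X}F_{L_{2,2}}(x)^2dx,\qquad \Delta_{2,2}=\xi J(U_{2,2})-\bar\xi J(L_{2,2}),$$ where the two extropies take values in $[-\infty,0]$. Assume that $\Delta_{2,2}\in[-\infty,\infty]$ is well defined, i.e. that $\xi J(U_{2,2})$ and $\bar\xi J(L_{2,2})$ are not both $-\infty$. For a sample $X_1,\dots,X_N$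 with order statistics $X_{1:N}\le\dots\le X_{N:N}$ and a window size $m$, let $$\widehat\Delta_{2,2}=-\frac1{2N}\sum_{i=1}^N\left[\Bigl(1-\tfrac{i}{N+1}\Bigr)^4\Bigl(1-2\log\bigl(1-\tfrac{i}{N+1}\bigr)\Bigr)^2-\Bigl(\tfrac{i}{N+1}\Bigr)^4\Bigl(1-2\log\tfrac{i}{N+1}\Bigr)^2\right]\frac{X_{i+m:N}-X_{i-m:N}}{2m/N},$$ where $X_{j:N}=X_{N:N}$ for $j>N$ and $X_{j:N}=X_{1:N}$ for $j<1$. Then for every sequence $m=m_N$ of positive integers with $m_N\to\infty$ and $m_N/N\to0$, $\widehat\Delta_{2,2}$ converges in probability to $\Delta_{2,2}$ as $N\to\infty$. That is: if $\Delta_{2,2}$ is finite, then $P(|\widehat\Delta_{2,2}-\Delta_{2,2}|\ge\varepsilon)\to0$ for every $\varepsilon>0$; if $\Delta_{2,2}=+\infty$, then $P(\widehat\Delta_{2,2}\le M)\to0$ for every real $M$; and if $\Delta_{2,2}=-\infty$, then $P(\widehat\Delta_{2,2}\ge M)\to0$ for every real $M$. -/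

import Mathlib

open MeasureTheory ProbabilityTheory Filter Topology
open scoped ENNReal

/-- The cdf of the `n`-th upper `k`-record value of a population with continuous cdf `F`. -/
noncomputable def upperRecordCDF (n k : ℕ) (F : ℝ → ℝ) (x : ℝ) : ℝ :=
  1 - (1 - F x) ^ k *
    ∑ i ∈ Finset.range n, (-(k : ℝ) * Real.log (1 - F x)) ^ i / (Nat.factorial i : ℝ)

/-- The cdf of the `n`-th lower `k`-record value of a population with continuous cdf `F`. -/
noncomputable def lowerRecordCDF (n k : ℕ) (F : ℝ → ℝ) (x : ℝ) : ℝ :=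
  (F x) ^ k *
    ∑ i ∈ Finset.range n, (-(k : ℝ) * Real.log (F x)) ^ i / (Nat.factorial i : ℝ)

/-- The support interval of a distribution with continuous cdf `G`: all the points strictly
between the left and the right endpoint of the distribution. -/
def supportInterval (G : ℝ → ℝ) : Set ℝ := {x | 0 < G x ∧ G x < 1}

/-- Cumulative residual extropy `-(1/2) ∫_S (1 - G(x))² dx` of a distribution with cdf `G` and
support interval `S`; the integrand is nonnegative, and the value is `⊥ = -∞` if the integral
diverges. -/
noncomputable def cumResidualExtropy (G : ℝ → ℝ) : EReal :=
  -(((1 / 2 : ℝ≥0∞) * ∫⁻ x in supportInterval G, ENNReal.ofReal ((1 - G x) ^ 2) : ℝ≥0∞) : EReal)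

/-- Cumulative past extropy `-(1/2) ∫_S G(x)² dx` of a distribution with cdf `G` and
support interval `S`; the value is `⊥ = -∞` if the integral diverges. -/
noncomputable def cumPastExtropy (G : ℝ → ℝ) : EReal :=
  -(((1 / 2 : ℝ≥0∞) * ∫⁻ x in supportInterval G, ENNReal.ofReal ((G x) ^ 2) : ℝ≥0∞) : EReal)

/-- `Δ_{n,k}`: the cumulative residual extropy of the `n`-th upper `k`-record value minus the
cumulative past extropy of the `n`-th lower `k`-record value. It is meaningful as soon as the two
extropies are not both `-∞`. -/
noncomputable def recordExtropyDiff (n k : ℕ) (F : ℝ → ℝ) : EReal :=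
  cumResidualExtropy (upperRecordCDF n k F) - cumPastExtropy (lowerRecordCDF n k F)

/-- The order statistics of a sample `x`, in nondecreasing order (`orderStat x j` is the
`(j+1)`-th smallest value, as `Fin N` starts at `0`). -/
noncomputable def orderStat {N : ℕ} (x : Fin N → ℝ) (j : Fin N) : ℝ := x (Tuple.sort x j)

/-- The `2m`-spacing `X_{i+m:N} - X_{i-m:N}`, where an index above `N` is replaced by `N` and an
index below `1` by `1`. Here `i : Fin N` stands for the index `i + 1`, so that the largest index is
`N - 1`, and the truncated subtraction `i - m` is the clamping at the smallest index. -/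
noncomputable def windowSpacing {N : ℕ} (x : Fin N → ℝ) (m : ℕ) (i : Fin N) : ℝ :=
  orderStat x ⟨min ((i : ℕ) + m) (N - 1), by have := i.isLt; omega⟩ -
    orderStat x ⟨(i : ℕ) - m, by have := i.isLt; omega⟩

/-- The weight `v⁴ (1 - 2 log v)²`. -/
noncomputable def recordWeight (v : ℝ) : ℝ := v ^ 4 * (1 - 2 * Real.log v) ^ 2

/-- The spacing-based estimator of `Δ_{2,2}` with window size `m` from a sample of size `N`. -/
noncomputable def extropyDiffEstimator {N : ℕ} (x : Fin N → ℝ) (m : ℕ) : ℝ :=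
  -(1 / (2 * (N : ℝ))) * ∑ i : Fin N,
    (recordWeight (1 - ((i : ℝ) + 1) / ((N : ℝ) + 1)) -
        recordWeight (((i : ℝ) + 1) / ((N : ℝ) + 1))) *
      (windowSpacing x m i / (2 * (m : ℝ) / (N : ℝ)))

/-! Write `w` for `recordWeight`, `S` for the support interval, A for the integral of `w(1 - F)`
over `S` and B for that of `w(F)`, so that the target is (B - A)/2. Each spacing is the length of an
interval between two order statistics. Summing the indicators of these intervals gives the estimator
as ∫ K_N(k(t)) dt (`integral_windowKernel`), where k(t) counts the sample points at most t and
K_N(k) is -1/2 times the average of `weightDiff` over about 2m ranks around k. Almost surely k(t)/N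
→ F(t) for all t at once, and m/N → 0, so the integrand tends to (w(F) - w(1 - F))/2 on `S`
(`tendsto_windowKernel`). It is bounded by 1/2 and vanishes outside `S`.

It remains to pass to the limit under the integral, for almost every sample sequence. Since `w(1 -
F)` is bounded below to the left of any point of `S`, finiteness of A forces that part of `S` to
have finite length; B does the same on the right. If both are finite, `S` has finite length and
dominated convergence applies. If exactly one is infinite, the integrand eventually has a fixed sign
on the side where the length may be infinite, because `weightDiff` changes sign at 1/2. Fatou's
lemma then gives divergence (`tendsto_integral_atTop_of_lintegral_eq_top`). -/

/-! ### The weight function -/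

/-- The survival function `t² (1 - 2 log t)` of the second `2`-record value, in terms of the
survival function `t` of the population. -/
noncomputable def recordSurvival (t : ℝ) : ℝ := t ^ 2 * (1 - 2 * Real.log t)

lemma recordSurvival_zero : recordSurvival 0 = 0 := by simp [recordSurvival]

lemma recordSurvival_one : recordSurvival 1 = 1 := by simp [recordSurvival]

lemma recordWeight_eq_sq (t : ℝ) : recordWeight t = recordSurvival t ^ 2 := by
  unfold recordWeight recordSurvival; ring

lemma continuous_recordSurvival : Continuous recordSurvival := by
  have h : recordSurvival = fun t => t ^ 2 - 2 * t * (t * Real.log t) := by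
    funext t; unfold recordSurvival; ring
  rw [h]
  have := Real.continuous_mul_log
  fun_prop

/-- The derivative is -4 t log t, positive on (0, 1). -/
lemma strictMonoOn_recordSurvival : StrictMonoOn recordSurvival (Set.Icc 0 1) := by
  refine strictMonoOn_of_deriv_pos (convex_Icc 0 1) continuous_recordSurvival.continuousOn ?_
  intro t ht
  rw [interior_Icc] at ht
  have h0 : t ≠ 0 := ht.1.ne'
  have hd : HasDerivAt recordSurvival
      ((2 : ℕ) * t ^ (2 - 1) * (1 - 2 * Real.log t) + t ^ 2 * (-(2 * t⁻¹))) t :=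
    (hasDerivAt_pow 2 t).mul (((Real.hasDerivAt_log h0).const_mul 2).const_sub 1)
  have he : ((2 : ℕ) : ℝ) * t ^ (2 - 1) * (1 - 2 * Real.log t) + t ^ 2 * (-(2 * t⁻¹))
      = 4 * t * (-Real.log t) := by
    field_simp; push_cast; ring
  rw [hd.deriv, he]
  have := Real.log_neg ht.1 ht.2
  have := ht.1
  exact mul_pos (by linarith) (by linarith)

lemma recordSurvival_mem_Icc {t : ℝ} (ht : t ∈ Set.Icc (0 : ℝ) 1) :
    recordSurvival t ∈ Set.Icc (0 : ℝ) 1 := by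
  have hm := strictMonoOn_recordSurvival.monotoneOn
  constructor
  · simpa [recordSurvival_zero] using hm (by simp) ht ht.1
  · simpa [recordSurvival_one] using hm ht (by simp) ht.2

lemma recordSurvival_mem_Ioo_iff {t : ℝ} (ht : t ∈ Set.Icc (0 : ℝ) 1) :
    recordSurvival t ∈ Set.Ioo (0 : ℝ) 1 ↔ t ∈ Set.Ioo (0 : ℝ) 1 := by
  have h0 := strictMonoOn_recordSurvival.lt_iff_lt (a := 0) (b := t) (by simp) ht
  have h1 := strictMonoOn_recordSurvival.lt_iff_lt (a := t) (b := 1) ht (by simp)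
  rw [recordSurvival_zero] at h0
  rw [recordSurvival_one] at h1
  simp only [Set.mem_Ioo, h0, h1]

lemma continuous_recordWeight : Continuous recordWeight := by
  have h : recordWeight = fun t => recordSurvival t ^ 2 := funext recordWeight_eq_sq
  rw [h]
  exact continuous_recordSurvival.pow 2

lemma recordWeight_nonneg (t : ℝ) : 0 ≤ recordWeight t := by
  rw [recordWeight_eq_sq]; positivity

lemma recordWeight_le_one {t : ℝ} (ht : t ∈ Set.Icc (0 : ℝ) 1) : recordWeight t ≤ 1 := by
  rw [recordWeight_eq_sq]
  have := recordSurvival_mem_Icc ht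
  exact pow_le_one₀ this.1 this.2

lemma monotoneOn_recordWeight : MonotoneOn recordWeight (Set.Icc 0 1) := by
  intro s hs t ht hst
  rw [recordWeight_eq_sq, recordWeight_eq_sq]
  exact pow_le_pow_left₀ (recordSurvival_mem_Icc hs).1
    (strictMonoOn_recordSurvival.monotoneOn hs ht hst) 2

lemma recordWeight_pos {t : ℝ} (ht : t ∈ Set.Ioo (0 : ℝ) 1) : 0 < recordWeight t := by
  rw [recordWeight_eq_sq]
  exact pow_pos ((recordSurvival_mem_Ioo_iff (Set.Ioo_subset_Icc_self ht)).2 ht).1 2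

/-- The difference of weights `w(1 - u) - w(u)`. -/
noncomputable def weightDiff (u : ℝ) : ℝ := recordWeight (1 - u) - recordWeight u

lemma continuous_weightDiff : Continuous weightDiff := by
  have := continuous_recordWeight
  unfold weightDiff
  fun_prop

lemma abs_weightDiff_le_one {u : ℝ} (hu : u ∈ Set.Icc (0 : ℝ) 1) : |weightDiff u| ≤ 1 := by
  have hu' : 1 - u ∈ Set.Icc (0 : ℝ) 1 := ⟨by linarith [hu.2], by linarith [hu.1]⟩
  have := recordWeight_le_one hu
  have := recordWeight_le_one hu'
  have := recordWeight_nonneg u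
  have := recordWeight_nonneg (1 - u)
  unfold weightDiff
  rw [abs_le]
  constructor <;> linarith

lemma weightDiff_nonpos {u : ℝ} (h : 1 / 2 ≤ u) (h1 : u ≤ 1) : weightDiff u ≤ 0 :=
  sub_nonpos.2 (monotoneOn_recordWeight ⟨by linarith, by linarith⟩ ⟨by linarith, h1⟩ (by linarith))

lemma weightDiff_nonneg {u : ℝ} (h0 : 0 ≤ u) (h : u ≤ 1 / 2) : 0 ≤ weightDiff u :=
  sub_nonneg.2 (monotoneOn_recordWeight ⟨h0, by linarith⟩ ⟨by linarith, by linarith⟩ (by linarith))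

lemma upperRecordCDF_two_two (F : ℝ → ℝ) (x : ℝ) :
    upperRecordCDF 2 2 F x = 1 - recordSurvival (1 - F x) := by
  simp only [upperRecordCDF, recordSurvival, Finset.sum_range_succ, Finset.sum_range_zero, pow_zero,
    pow_one, Nat.factorial]
  push_cast
  ring

lemma lowerRecordCDF_two_two (F : ℝ → ℝ) (x : ℝ) :
    lowerRecordCDF 2 2 F x = recordSurvival (F x) := by
  simp only [lowerRecordCDF, recordSurvival, Finset.sum_range_succ, Finset.sum_range_zero, pow_zero,
    pow_one, Nat.factorial]
  push_cast
  ring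

lemma supportInterval_upperRecordCDF {F : ℝ → ℝ} (h01 : ∀ t, F t ∈ Set.Icc (0 : ℝ) 1) :
    supportInterval (upperRecordCDF 2 2 F) = supportInterval F := by
  ext t
  have h := recordSurvival_mem_Ioo_iff (t := 1 - F t)
    ⟨by linarith [(h01 t).2], by linarith [(h01 t).1]⟩
  simp only [Set.mem_Ioo] at h
  simp only [supportInterval, Set.mem_ofPred_eq, upperRecordCDF_two_two]
  constructor
  · intro ⟨h1, h2⟩
    have := h.1 ⟨by linarith, by linarith⟩
    constructor <;> linarith
  · intro ⟨h1, h2⟩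
    have := h.2 ⟨by linarith, by linarith⟩
    constructor <;> linarith

lemma supportInterval_lowerRecordCDF {F : ℝ → ℝ} (h01 : ∀ t, F t ∈ Set.Icc (0 : ℝ) 1) :
    supportInterval (lowerRecordCDF 2 2 F) = supportInterval F := by
  ext t
  have h := recordSurvival_mem_Ioo_iff (h01 t)
  simp only [Set.mem_Ioo] at h
  simp only [supportInterval, Set.mem_ofPred_eq, lowerRecordCDF_two_two, h]

lemma cumResidualExtropy_upperRecordCDF {F : ℝ → ℝ} (h01 : ∀ t, F t ∈ Set.Icc (0 : ℝ) 1) :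
    cumResidualExtropy (upperRecordCDF 2 2 F) = -(((1 / 2 : ℝ≥0∞) *
      ∫⁻ t in supportInterval F, ENNReal.ofReal (recordWeight (1 - F t)) : ℝ≥0∞) : EReal) := by
  simp only [cumResidualExtropy, supportInterval_upperRecordCDF h01, upperRecordCDF_two_two,
    sub_sub_cancel, recordWeight_eq_sq]

lemma cumPastExtropy_lowerRecordCDF {F : ℝ → ℝ} (h01 : ∀ t, F t ∈ Set.Icc (0 : ℝ) 1) :
    cumPastExtropy (lowerRecordCDF 2 2 F) = -(((1 / 2 : ℝ≥0∞) *
      ∫⁻ t in supportInterval F, ENNReal.ofReal (recordWeight (F t)) : ℝ≥0∞) : EReal) := by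
  simp only [cumPastExtropy, supportInterval_lowerRecordCDF h01, lowerRecordCDF_two_two,
    recordWeight_eq_sq]

/-! ### Order statistics and empirical counts -/

/-- The number of sample points that are at most `t`. -/
noncomputable def sampleCount {N : ℕ} (x : Fin N → ℝ) (t : ℝ) : ℕ := {i | x i ≤ t}.ncard

lemma sampleCount_eq_card {N : ℕ} (x : Fin N → ℝ) (t : ℝ) :
    sampleCount x t = (Finset.univ.filter fun i => x i ≤ t).card := by
  rw [sampleCount, ← Set.ncard_coe_finset]
  simp

lemma sampleCount_mono {N : ℕ} (x : Fin N → ℝ) : Monotone (sampleCount x) := fun s t hst => by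
  rw [sampleCount_eq_card, sampleCount_eq_card]
  exact Finset.card_le_card fun i hi => by
    simp only [Finset.mem_filter, Finset.mem_univ, true_and] at hi ⊢
    exact hi.trans hst

lemma sampleCount_eq_zero {N : ℕ} {x : Fin N → ℝ} {t : ℝ} (h : ∀ i, t < x i) :
    sampleCount x t = 0 := by
  simp [sampleCount_eq_card, Finset.card_eq_zero, Finset.filter_eq_empty_iff, h]

lemma sampleCount_eq_self {N : ℕ} {x : Fin N → ℝ} {t : ℝ} (h : ∀ i, x i ≤ t) :
    sampleCount x t = N := by
  simp [sampleCount_eq_card, h]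

lemma sampleCount_eq_sum_indicator {N : ℕ} (x : Fin N → ℝ) (t : ℝ) :
    (sampleCount x t : ℝ) = ∑ i, (Set.Iic t).indicator (fun _ => (1 : ℝ)) (x i) := by
  simp only [sampleCount_eq_card, Set.indicator_apply, Set.mem_Iic, Finset.sum_boole]

/-- Duality between order statistics and counts; the inequality is strict because `j` starts at 0.
-/
lemma orderStat_le_iff {N : ℕ} (x : Fin N → ℝ) (j : Fin N) (t : ℝ) :
    orderStat x j ≤ t ↔ (j : ℕ) < sampleCount x t := by
  have h := Tuple.lt_card_le_iff_apply_le_of_monotone (j := j) (a := t) (Tuple.monotone_sort x)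
  rw [orderStat, ← Function.comp_apply (f := x), ← h, sampleCount_eq_card]
  have hc : (Finset.univ.filter fun i => (x ∘ Tuple.sort x) i ≤ t).card
      = (Finset.univ.filter fun i => x i ≤ t).card :=
    Finset.card_equiv (Tuple.sort x) (by simp)
  rw [hc]

lemma monotone_orderStat {N : ℕ} (x : Fin N → ℝ) : Monotone (orderStat x) := Tuple.monotone_sort x

/-- By the duality, sublevel sets are described by a sum of indicators, so the sorting permutation
need not be studied. -/
lemma measurable_orderStat {N : ℕ} (j : Fin N) :
    Measurable fun x : Fin N → ℝ => orderStat x j := by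
  refine measurable_of_Iic fun t => ?_
  have h : (fun x : Fin N → ℝ => orderStat x j) ⁻¹' Set.Iic t = {x | ((j : ℕ) : ℝ) <
      ∑ i, (Set.Iic t).indicator (fun _ => (1 : ℝ)) (x i)} := by
    ext x
    simp only [Set.mem_preimage, Set.mem_Iic, orderStat_le_iff, Set.mem_ofPred_eq,
      ← sampleCount_eq_sum_indicator, Nat.cast_lt]
  rw [h]
  refine measurableSet_lt measurable_const (Finset.measurable_fun_sum _ fun i _ => ?_)
  exact (measurable_const.indicator measurableSet_Iic).comp (measurable_pi_apply i)

lemma measurable_extropyDiffEstimator (N m : ℕ) :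
    Measurable fun x : Fin N → ℝ => extropyDiffEstimator x m := by
  unfold extropyDiffEstimator windowSpacing
  refine (Finset.measurable_fun_sum _ fun i _ => ?_).const_mul _
  exact (((measurable_orderStat _).sub (measurable_orderStat _)).div_const _).const_mul _

/-! ### The estimator as an integral -/

/-- The weight that the estimator gives to a point with `k` sample points below it. -/
noncomputable def windowKernel (N m k : ℕ) : ℝ :=
  -(1 / (4 * (m : ℝ))) * ∑ i : Fin N,
    if ((i : ℕ) < k + m ∧ k ≤ (i : ℕ) + m) ∧ 0 < k ∧ k < N then
      weightDiff (((i : ℝ) + 1) / ((N : ℝ) + 1)) else 0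

/-- Both endpoint conditions translate into conditions on the count k. Clamping the lower index
contributes `0 < k`, clamping the upper one `k < N`. -/
lemma windowKernel_eq_sum_indicator {N : ℕ} (x : Fin N → ℝ) (m : ℕ) (t : ℝ) :
    windowKernel N m (sampleCount x t) = -(1 / (4 * (m : ℝ))) * ∑ i : Fin N,
      (Set.Ico (orderStat x ⟨(i : ℕ) - m, by have := i.isLt; omega⟩)
        (orderStat x ⟨min ((i : ℕ) + m) (N - 1), by have := i.isLt; omega⟩)).indicator
        (fun _ => weightDiff (((i : ℝ) + 1) / ((N : ℝ) + 1))) t := by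
  unfold windowKernel
  congr 1
  refine Finset.sum_congr rfl fun i _ => ?_
  rw [Set.indicator_apply]
  have := i.isLt
  refine if_congr ?_ rfl rfl
  rw [Set.mem_Ico, ← not_le (a := orderStat x _), orderStat_le_iff, orderStat_le_iff]
  simp only
  omega

lemma integrable_windowKernel {N : ℕ} (x : Fin N → ℝ) (m : ℕ) :
    Integrable fun t => windowKernel N m (sampleCount x t) := by
  simp_rw [windowKernel_eq_sum_indicator]
  refine (integrable_finsetSum _ fun i _ => ?_).const_mul _
  exact (integrable_indicator_iff measurableSet_Ico).2 (integrableOn_const (by simp))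

/-- The indicators integrate to the spacings, and 1/(4m) is the product of 1/(2N) and N/(2m). -/
lemma integral_windowKernel {N : ℕ} (x : Fin N → ℝ) (m : ℕ) :
    ∫ t, windowKernel N m (sampleCount x t) = extropyDiffEstimator x m := by
  simp_rw [windowKernel_eq_sum_indicator]
  rw [integral_const_mul, integral_finsetSum]
  swap
  · exact fun i _ => (integrable_indicator_iff measurableSet_Ico).2 (integrableOn_const (by simp))
  unfold extropyDiffEstimator
  rw [Finset.mul_sum, Finset.mul_sum]
  refine Finset.sum_congr rfl fun i _ => ?_
  rw [integral_indicator measurableSet_Ico, setIntegral_const, Real.volume_real_Ico_of_le]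
  · have hN : (N : ℝ) ≠ 0 := by
      have := i.isLt
      exact_mod_cast (by omega : N ≠ 0)
    rw [smul_eq_mul, windowSpacing, weightDiff]
    -- For m = 0 both sides vanish, since division by zero gives zero.
    rcases eq_or_ne m 0 with rfl | hm
    · simp
    · have hm' : (m : ℝ) ≠ 0 := by exact_mod_cast hm
      field_simp
      ring
  · refine monotone_orderStat x ?_
    have := i.isLt
    simp only [Fin.mk_le_mk]
    omega

lemma windowKernel_zero (N m : ℕ) : windowKernel N m 0 = 0 := by simp [windowKernel]

lemma windowKernel_self (N m : ℕ) : windowKernel N m N = 0 := by simp [windowKernel]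

lemma rank_mem_Icc {N : ℕ} (i : Fin N) :
    ((i : ℝ) + 1) / ((N : ℝ) + 1) ∈ Set.Icc (0 : ℝ) 1 := by
  have : ((i : ℕ) : ℝ) ≤ N := by exact_mod_cast i.isLt.le
  exact ⟨by positivity, (div_le_one (by positivity)).2 (by linarith)⟩

lemma card_window_le (N m k : ℕ) :
    (Finset.univ.filter fun i : Fin N => (i : ℕ) < k + m ∧ k ≤ (i : ℕ) + m).card ≤ 2 * m := by
  calc _ = ((Finset.univ.filter fun i : Fin N => (i : ℕ) < k + m ∧ k ≤ (i : ℕ) + m).image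
        (fun i : Fin N => (i : ℕ))).card := (Finset.card_image_of_injective _ Fin.val_injective).symm
    _ ≤ (Finset.Ico (k - m) (k + m)).card := by
        refine Finset.card_le_card fun j hj => ?_
        simp only [Finset.mem_image, Finset.mem_filter, Finset.mem_univ, true_and] at hj
        obtain ⟨i, hi, rfl⟩ := hj
        rw [Finset.mem_Ico]
        omega
    _ ≤ 2 * m := by rw [Nat.card_Ico]; omega

lemma card_window_eq {N m k : ℕ} (h1 : m ≤ k) (h2 : k + m ≤ N) :
    (Finset.univ.filter fun i : Fin N => (i : ℕ) < k + m ∧ k ≤ (i : ℕ) + m).card = 2 * m := by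
  rw [← Finset.card_image_of_injective _ Fin.val_injective]
  have : (Finset.univ.filter fun i : Fin N => (i : ℕ) < k + m ∧ k ≤ (i : ℕ) + m).image
      (fun i : Fin N => (i : ℕ)) = Finset.Ico (k - m) (k + m) := by
    ext j
    simp only [Finset.mem_image, Finset.mem_filter, Finset.mem_univ, true_and, Finset.mem_Ico]
    constructor
    · rintro ⟨i, hi, rfl⟩
      omega
    · intro hj
      exact ⟨⟨j, by omega⟩, by simp only; omega, rfl⟩
  rw [this, Nat.card_Ico]
  omega

/-- Away from both ends the window has exactly 2m ranks, so the kernel is -1/2 times a true average.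
-/
lemma abs_windowKernel_sub_le {N m k : ℕ} {c ε : ℝ} (hm : 0 < m) (h1 : m ≤ k) (h2 : k + m ≤ N)
    (hk : k < N) (hc : ∀ i : Fin N, (i : ℕ) < k + m → k ≤ (i : ℕ) + m →
      |weightDiff (((i : ℝ) + 1) / ((N : ℝ) + 1)) - c| ≤ ε) :
    |windowKernel N m k - (-(1 / 2) * c)| ≤ ε / 2 := by
  have hm' : (0 : ℝ) < m := by exact_mod_cast hm
  set s := Finset.univ.filter fun i : Fin N => (i : ℕ) < k + m ∧ k ≤ (i : ℕ) + m with hs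
  have hcard : (s.card : ℝ) = 2 * m := by exact_mod_cast card_window_eq h1 h2
  have he : windowKernel N m k - (-(1 / 2) * c) = -(1 / (4 * (m : ℝ))) *
      ∑ i ∈ s, (weightDiff (((i : ℝ) + 1) / ((N : ℝ) + 1)) - c) := by
    rw [Finset.sum_sub_distrib, Finset.sum_const, nsmul_eq_mul, hcard, windowKernel, hs,
      Finset.sum_filter]
    simp only [show 0 < k by omega, hk, and_self, and_true]
    field_simp
    ring
  rw [he, abs_mul, abs_neg, abs_of_pos (by positivity)]
  have : |∑ i ∈ s, (weightDiff (((i : ℝ) + 1) / ((N : ℝ) + 1)) - c)| ≤ 2 * m * ε := by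
    refine (Finset.abs_sum_le_sum_abs _ _).trans ?_
    refine (Finset.sum_le_card_nsmul s _ ε fun i hi => ?_).trans (by rw [nsmul_eq_mul, hcard])
    have := (Finset.mem_filter.1 hi).2
    exact hc i this.1 this.2
  calc 1 / (4 * (m : ℝ)) * |_| ≤ 1 / (4 * (m : ℝ)) * (2 * m * ε) := by gcongr
    _ = ε / 2 := by field_simp; ring

lemma abs_windowKernel_le (N m k : ℕ) : |windowKernel N m k| ≤ 1 / 2 := by
  rcases eq_or_ne m 0 with rfl | hm
  · simp [windowKernel]
  have hm' : (0 : ℝ) < m := by exact_mod_cast Nat.pos_of_ne_zero hm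
  rw [windowKernel, abs_mul, abs_neg, abs_of_pos (by positivity)]
  have : |∑ i : Fin N, if ((i : ℕ) < k + m ∧ k ≤ (i : ℕ) + m) ∧ 0 < k ∧ k < N then
      weightDiff (((i : ℝ) + 1) / ((N : ℝ) + 1)) else 0| ≤ 2 * m := by
    refine (Finset.abs_sum_le_sum_abs _ _).trans ?_
    calc _ ≤ ∑ i : Fin N, if (i : ℕ) < k + m ∧ k ≤ (i : ℕ) + m then (1 : ℝ) else 0 := by
          refine Finset.sum_le_sum fun i _ => ?_
          have := abs_weightDiff_le_one (rank_mem_Icc i)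
          by_cases h : (i : ℕ) < k + m ∧ k ≤ (i : ℕ) + m
          · rw [if_pos h]
            split_ifs
            · exact this
            · simp
          · rw [if_neg h, if_neg (fun h' => h h'.1), abs_zero]
      _ ≤ 2 * m := by
          rw [Finset.sum_boole]
          exact_mod_cast card_window_le N m k
  calc 1 / (4 * (m : ℝ)) * |_| ≤ 1 / (4 * (m : ℝ)) * (2 * m) := by gcongr
    _ = 1 / 2 := by field_simp; ring

/-- All ranks in the window lie in the upper half, where `weightDiff` is nonpositive. -/
lemma windowKernel_nonneg {N m k : ℕ} (h : N + 2 * m ≤ 2 * k) : 0 ≤ windowKernel N m k := by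
  refine mul_nonneg_of_nonpos_of_nonpos (by simp)
    (Finset.sum_nonpos fun i _ => ?_)
  split_ifs with hi
  · refine weightDiff_nonpos ?_ (rank_mem_Icc i).2
    rw [div_le_div_iff₀ (by norm_num) (by positivity)]
    have : N + 1 ≤ 2 * ((i : ℕ) + 1) := by omega
    have : (N : ℝ) + 1 ≤ 2 * ((i : ℕ) + 1) := by exact_mod_cast this
    linarith
  · exact le_rfl

lemma windowKernel_nonpos {N m k : ℕ} (h : 2 * k + 2 * m ≤ N) : windowKernel N m k ≤ 0 := by
  refine mul_nonpos_of_nonpos_of_nonneg (by simp)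
    (Finset.sum_nonneg fun i _ => ?_)
  split_ifs with hi
  · refine weightDiff_nonneg (rank_mem_Icc i).1 ?_
    rw [div_le_div_iff₀ (by positivity) (by norm_num)]
    have : 2 * ((i : ℕ) + 1) ≤ N + 1 := by omega
    have : 2 * ((i : ℕ) + 1) ≤ (N : ℝ) + 1 := by exact_mod_cast this
    linarith
  · exact le_rfl

lemma tendsto_windowKernel {m k : ℕ → ℕ} {p : ℝ} (hp : p ∈ Set.Ioo (0 : ℝ) 1)
    (hm : Tendsto m atTop atTop)
    (hmN : Tendsto (fun N : ℕ => (m N : ℝ) / (N : ℝ)) atTop (𝓝 0))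
    (hk : Tendsto (fun N : ℕ => (k N : ℝ) / (N : ℝ)) atTop (𝓝 p)) :
    Tendsto (fun N => windowKernel N (m N) (k N)) atTop (𝓝 (-(1 / 2) * weightDiff p)) := by
  rw [Metric.tendsto_atTop']
  intro ε hε
  obtain ⟨δ, hδ, hδε⟩ := Metric.continuousAt_iff.1 (continuous_weightDiff.continuousAt (x := p)) ε hε
  have e1 : ∀ᶠ N in atTop, 0 < m N := hm.eventually_gt_atTop 0
  have hsub : Tendsto (fun N : ℕ => (k N : ℝ) / (N : ℝ) - (m N : ℝ) / (N : ℝ)) atTop (𝓝 p) := by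
    simpa using hk.sub hmN
  have hadd : Tendsto (fun N : ℕ => (k N : ℝ) / (N : ℝ) + (m N : ℝ) / (N : ℝ)) atTop (𝓝 p) := by
    simpa using hk.add hmN
  have hlim : Tendsto (fun N : ℕ => (m N : ℝ) / (N : ℝ) + |(k N : ℝ) / (N : ℝ) - p|
      + 1 / (N : ℝ)) atTop (𝓝 0) := by
    have := (hmN.add (hk.sub_const p).abs).add tendsto_one_div_atTop_nhds_zero_nat
    simpa using this
  have hev : ∀ᶠ N : ℕ in atTop, dist (windowKernel N (m N) (k N)) (-(1 / 2) * weightDiff p) < ε := by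
    filter_upwards [e1, hsub.eventually (lt_mem_nhds hp.1), hadd.eventually (gt_mem_nhds hp.2),
      hlim.eventually (gt_mem_nhds hδ), eventually_gt_atTop 0] with N h1 h2 h3 h4 h5
    have hN : (0 : ℝ) < N := by exact_mod_cast h5
    have a1 : m N < k N := by
      rw [← sub_div] at h2
      have := (div_pos_iff_of_pos_right hN).1 h2
      exact_mod_cast (by linarith : (m N : ℝ) < k N)
    have a2 : k N + m N < N := by
      rw [← add_div, div_lt_one hN] at h3
      exact_mod_cast h3
    rw [Real.dist_eq]
    refine (abs_windowKernel_sub_le (ε := ε) h1 a1.le a2.le (by omega) ?_).trans_lt (by linarith)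
    intro i hi1 hi2
    have hi1' : ((i : ℕ) : ℝ) ≤ k N + m N := by exact_mod_cast hi1.le
    have hi2' : (k N : ℝ) ≤ (i : ℕ) + m N := by exact_mod_cast hi2
    have := hδε (x := ((i : ℝ) + 1) / ((N : ℝ) + 1)) ?_
    · rw [Real.dist_eq] at this
      exact this.le
    refine lt_of_le_of_lt ?_ h4
    have key : |(k N : ℝ) / (N : ℝ) - p| = |(k N : ℝ) - p * N| / N := by
      rw [← abs_of_pos hN, ← abs_div, abs_of_pos hN]
      congr 1
      field_simp
    have key2 : ((i : ℝ) + 1) / ((N : ℝ) + 1) - p = ((i : ℝ) + 1 - p * (N + 1)) / (N + 1) := by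
      field_simp
    rw [Real.dist_eq, key, key2, abs_div, abs_of_pos (by positivity : (0 : ℝ) < N + 1), ← add_div,
      ← add_div]
    -- Split the left side as (i - k) + (k - pN) + (1 - p), with |i - k| ≤ m.
    have hb : |(i : ℝ) + 1 - p * (N + 1)| ≤ (m N : ℝ) + |(k N : ℝ) - p * N| + 1 := by
      have h6 := abs_le.1 (le_refl |(k N : ℝ) - p * N|)
      rw [abs_le]
      constructor <;> linarith [hp.1, hp.2]
    calc _ ≤ |(i : ℝ) + 1 - p * (N + 1)| / N := by gcongr; linarith
      _ ≤ _ := by gcongr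
  obtain ⟨N, hN⟩ := eventually_atTop.1 hev
  exact ⟨N, fun n hn => hN n (le_of_lt hn)⟩

/-! ### Convergence along a fixed sample sequence -/

/-- The integrals of functions that are eventually bounded below by a fixed integrable function
diverge to `∞` if the pointwise limit has infinite integral. -/
lemma tendsto_integral_atTop_of_lintegral_eq_top {α : Type*} [MeasurableSpace α] {ν : Measure α}
    {φ : ℕ → α → ℝ} {g h : α → ℝ} (hφ : ∀ n, Integrable (φ n) ν) (hh : Integrable h ν)
    (hlow : ∀ᶠ n in atTop, ∀ t, 0 ≤ φ n t + h t)
    (hlim : ∀ t, Tendsto (fun n => φ n t) atTop (𝓝 (g t)))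
    (htop : ∫⁻ t, ENNReal.ofReal (g t + h t) ∂ν = ∞) :
    Tendsto (fun n => ∫ t, φ n t ∂ν) atTop atTop := by
  have hF : Tendsto (fun n => ∫⁻ t, ENNReal.ofReal (φ n t + h t) ∂ν) atTop (𝓝 ∞) := by
    -- Fatou's lemma for the eventually nonnegative functions `φ n + h`.
    refine tendsto_of_le_liminf_of_limsup_le ?_ le_top
    rw [← htop]
    have he : ∀ t, ENNReal.ofReal (g t + h t)
        = liminf (fun n => ENNReal.ofReal (φ n t + h t)) atTop := fun t =>
      (((ENNReal.continuous_ofReal.tendsto _).comp ((hlim t).add_const (h t))).liminf_eq).symm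
    simp_rw [he]
    exact lintegral_liminf_le' fun n => ((hφ n).add hh).aemeasurable.ennreal_ofReal
  refine tendsto_atTop.2 fun M => ?_
  filter_upwards [hlow, hF.eventually (lt_mem_nhds (ENNReal.ofReal_lt_top (r := M + ∫ t, h t ∂ν)))]
    with n h1 h2
  have h3 := ofReal_integral_eq_lintegral_ofReal ((hφ n).add hh) (Eventually.of_forall h1)
  simp only [Pi.add_apply] at h3
  rw [← h3, integral_add (hφ n) hh, ENNReal.ofReal_lt_ofReal_iff'] at h2
  linarith [h2.1]

/-- Markov's inequality. It turns a finite extropy into finite length of a part of the support. -/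
lemma measure_ne_top_of_setLIntegral_ne_top {α : Type*} [MeasurableSpace α] {ν : Measure α}
    {T U : Set α} {f : α → ℝ} {c : ℝ} (hc : 0 < c) (hT : MeasurableSet T) (hTU : T ⊆ U)
    (hf : ∀ t ∈ T, c ≤ f t) (h : ∫⁻ t in U, ENNReal.ofReal (f t) ∂ν ≠ ∞) : ν T ≠ ∞ := by
  intro hν
  refine h (top_le_iff.1 ?_)
  calc ∞ = ∫⁻ _ in T, ENNReal.ofReal c ∂ν := by
        rw [setLIntegral_const, hν, ENNReal.mul_top (by simpa using hc)]
    _ ≤ ∫⁻ t in T, ENNReal.ofReal (f t) ∂ν :=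
        setLIntegral_mono' hT fun t ht => ENNReal.ofReal_le_ofReal (hf t ht)
    _ ≤ _ := lintegral_mono_set hTU

section Deterministic

variable {F : ℝ → ℝ} {x : ℕ → ℝ} {m : ℕ → ℕ}

lemma measurableSet_supportInterval (hF : Monotone F) : MeasurableSet (supportInterval F) :=
  (measurableSet_lt measurable_const hF.measurable).inter
    (measurableSet_lt hF.measurable measurable_const)

/-- Such a point lies below or above the whole sample, so the count is 0 or N, where the kernel
vanishes. -/
lemma windowKernel_sampleCount_eq_zero (hF : Monotone F) (h01 : ∀ t, F t ∈ Set.Icc (0 : ℝ) 1)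
    (hx : ∀ i, x i ∈ supportInterval F) (N m : ℕ) {t : ℝ} (ht : t ∉ supportInterval F) :
    windowKernel N m (sampleCount (fun i : Fin N => x i) t) = 0 := by
  by_cases h0 : 0 < F t
  · have h1 : F t = 1 := le_antisymm (h01 t).2 (not_lt.1 fun h => ht ⟨h0, h⟩)
    rw [sampleCount_eq_self, windowKernel_self]
    intro i
    by_contra! hlt
    exact absurd (hF hlt.le) (by rw [h1]; exact not_le.2 (hx i).2)
  · rw [sampleCount_eq_zero, windowKernel_zero]
    intro i
    by_contra! hle
    exact h0 ((hx i).1.trans_le (hF hle))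

lemma tendsto_windowKernel_sampleCount (hF : Monotone F) (h01 : ∀ t, F t ∈ Set.Icc (0 : ℝ) 1)
    (hx : ∀ i, x i ∈ supportInterval F)
    (hcount : ∀ t, Tendsto (fun N => (sampleCount (fun i : Fin N => x i) t : ℝ) / N) atTop
      (𝓝 (F t)))
    (hm : Tendsto m atTop atTop)
    (hmN : Tendsto (fun N : ℕ => (m N : ℝ) / (N : ℝ)) atTop (𝓝 0)) (t : ℝ) :
    Tendsto (fun N => windowKernel N (m N) (sampleCount (fun i : Fin N => x i) t)) atTop
      (𝓝 ((supportInterval F).indicator (fun s => -(1 / 2) * weightDiff (F s)) t)) := by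
  by_cases ht : t ∈ supportInterval F
  · rw [Set.indicator_of_mem ht]
    exact tendsto_windowKernel ht hm hmN (hcount t)
  · rw [Set.indicator_of_notMem ht]
    simp_rw [windowKernel_sampleCount_eq_zero hF h01 hx _ _ ht]
    exact tendsto_const_nhds

lemma abs_windowKernel_sampleCount_le (hF : Monotone F) (h01 : ∀ t, F t ∈ Set.Icc (0 : ℝ) 1)
    (hx : ∀ i, x i ∈ supportInterval F) (N m : ℕ) (t : ℝ) :
    |windowKernel N m (sampleCount (fun i : Fin N => x i) t)| ≤
      (supportInterval F).indicator (fun _ => (1 / 2 : ℝ)) t := by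
  by_cases ht : t ∈ supportInterval F
  · rw [Set.indicator_of_mem ht]
    exact abs_windowKernel_le _ _ _
  · rw [Set.indicator_of_notMem ht, windowKernel_sampleCount_eq_zero hF h01 hx _ _ ht, abs_zero]

lemma recordWeight_one_sub_le {s t : ℝ} (h01 : ∀ t, F t ∈ Set.Icc (0 : ℝ) 1)
    (h : F s ≤ F t) : recordWeight (1 - F t) ≤ recordWeight (1 - F s) :=
  monotoneOn_recordWeight ⟨by linarith [(h01 t).2], by linarith [(h01 t).1]⟩
    ⟨by linarith [(h01 s).2], by linarith [(h01 s).1]⟩ (by linarith)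

lemma setIntegral_weightDiff (hF : Monotone F)
    (hA : ∫⁻ t in supportInterval F, ENNReal.ofReal (recordWeight (1 - F t)) ≠ ∞)
    (hB : ∫⁻ t in supportInterval F, ENNReal.ofReal (recordWeight (F t)) ≠ ∞) :
    ∫ t in supportInterval F, -(1 / 2) * weightDiff (F t) =
      ((∫⁻ t in supportInterval F, ENNReal.ofReal (recordWeight (F t))).toReal -
        (∫⁻ t in supportInterval F, ENNReal.ofReal (recordWeight (1 - F t))).toReal) / 2 := by
  have m1 : Measurable fun t => recordWeight (1 - F t) :=
    continuous_recordWeight.measurable.comp (measurable_const.sub hF.measurable)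
  have m2 : Measurable fun t => recordWeight (F t) :=
    continuous_recordWeight.measurable.comp hF.measurable
  have n1 : 0 ≤ᵐ[volume.restrict (supportInterval F)] fun t => recordWeight (1 - F t) :=
    Eventually.of_forall fun _ => recordWeight_nonneg _
  have n2 : 0 ≤ᵐ[volume.restrict (supportInterval F)] fun t => recordWeight (F t) :=
    Eventually.of_forall fun _ => recordWeight_nonneg _
  have i1 := lintegral_ofReal_ne_top_iff_integrable m1.aestronglyMeasurable n1 |>.1 hA
  have i2 := lintegral_ofReal_ne_top_iff_integrable m2.aestronglyMeasurable n2 |>.1 hB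
  rw [integral_const_mul]
  unfold weightDiff
  rw [integral_sub i1 i2, integral_eq_lintegral_of_nonneg_ae n1 m1.aestronglyMeasurable,
    integral_eq_lintegral_of_nonneg_ae n2 m2.aestronglyMeasurable]
  ring

/-- At every point one of F and 1 - F is at least 1/2, so one of the two integrands is at least
w(1/2). -/
lemma volume_supportInterval_ne_top (hF : Monotone F) (h01 : ∀ t, F t ∈ Set.Icc (0 : ℝ) 1)
    (hA : ∫⁻ t in supportInterval F, ENNReal.ofReal (recordWeight (1 - F t)) ≠ ∞)
    (hB : ∫⁻ t in supportInterval F, ENNReal.ofReal (recordWeight (F t)) ≠ ∞) :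
    volume (supportInterval F) ≠ ∞ := by
  have hw : 0 < recordWeight (1 / 2) := recordWeight_pos ⟨by norm_num, by norm_num⟩
  have hS := measurableSet_supportInterval hF
  have h1 : volume (supportInterval F ∩ {t | F t ≤ 1 / 2}) ≠ ∞ :=
    measure_ne_top_of_setLIntegral_ne_top hw
      (hS.inter (measurableSet_le hF.measurable measurable_const)) Set.inter_subset_left
      (fun t ht => monotoneOn_recordWeight ⟨by norm_num, by norm_num⟩
        ⟨by linarith [(h01 t).2], by linarith [(h01 t).1]⟩
        (by have : F t ≤ 1 / 2 := ht.2; linarith)) hA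
  have h2 : volume (supportInterval F ∩ {t | 1 / 2 ≤ F t}) ≠ ∞ :=
    measure_ne_top_of_setLIntegral_ne_top hw
      (hS.inter (measurableSet_le measurable_const hF.measurable)) Set.inter_subset_left
      (fun t ht => monotoneOn_recordWeight ⟨by norm_num, by norm_num⟩ (h01 t) ht.2) hB
  refine ne_top_of_le_ne_top (ENNReal.add_ne_top.2 ⟨h1, h2⟩)
    ((measure_mono fun t ht => ?_).trans (measure_union_le _ _))
  exact (le_total (F t) (1 / 2)).imp (fun h => ⟨ht, h⟩) (fun h => ⟨ht, h⟩)

lemma tendsto_extropyDiffEstimator (hF : Monotone F) (h01 : ∀ t, F t ∈ Set.Icc (0 : ℝ) 1)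
    (hx : ∀ i, x i ∈ supportInterval F)
    (hcount : ∀ t, Tendsto (fun N => (sampleCount (fun i : Fin N => x i) t : ℝ) / N) atTop
      (𝓝 (F t)))
    (hm : Tendsto m atTop atTop)
    (hmN : Tendsto (fun N : ℕ => (m N : ℝ) / (N : ℝ)) atTop (𝓝 0))
    (hA : ∫⁻ t in supportInterval F, ENNReal.ofReal (recordWeight (1 - F t)) ≠ ∞)
    (hB : ∫⁻ t in supportInterval F, ENNReal.ofReal (recordWeight (F t)) ≠ ∞) :
    Tendsto (fun N => extropyDiffEstimator (fun i : Fin N => x i) (m N)) atTop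
      (𝓝 (((∫⁻ t in supportInterval F, ENNReal.ofReal (recordWeight (F t))).toReal -
        (∫⁻ t in supportInterval F, ENNReal.ofReal (recordWeight (1 - F t))).toReal) / 2)) := by
  have hS := measurableSet_supportInterval hF
  rw [← setIntegral_weightDiff hF hA hB, ← integral_indicator hS]
  simp_rw [← integral_windowKernel]
  refine tendsto_integral_of_dominated_convergence
    ((supportInterval F).indicator fun _ => (1 / 2 : ℝ))
    (fun N => (integrable_windowKernel _ _).aestronglyMeasurable)
    ((integrable_indicator_iff hS).2
      (integrableOn_const (volume_supportInterval_ne_top hF h01 hA hB)))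
    (fun N => Eventually.of_forall fun t => abs_windowKernel_sampleCount_le hF h01 hx N (m N) t)
    (Eventually.of_forall fun t => tendsto_windowKernel_sampleCount hF h01 hx hcount hm hmN t)

lemma tendsto_extropyDiffEstimator_atTop (hF : Monotone F) (h01 : ∀ t, F t ∈ Set.Icc (0 : ℝ) 1)
    (hx : ∀ i, x i ∈ supportInterval F)
    (hcount : ∀ t, Tendsto (fun N => (sampleCount (fun i : Fin N => x i) t : ℝ) / N) atTop
      (𝓝 (F t)))
    (hm : Tendsto m atTop atTop)
    (hmN : Tendsto (fun N : ℕ => (m N : ℝ) / (N : ℝ)) atTop (𝓝 0))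
    (hA : ∫⁻ t in supportInterval F, ENNReal.ofReal (recordWeight (1 - F t)) ≠ ∞)
    (hB : ∫⁻ t in supportInterval F, ENNReal.ofReal (recordWeight (F t)) = ∞) :
    Tendsto (fun N => extropyDiffEstimator (fun i : Fin N => x i) (m N)) atTop atTop := by
  have hS := measurableSet_supportInterval hF
  have hbdd : ∀ c ∈ supportInterval F, volume (supportInterval F ∩ Set.Iic c) ≠ ∞ := fun c hc =>
    measure_ne_top_of_setLIntegral_ne_top
      (recordWeight_pos (t := 1 - F c) ⟨by linarith [hc.2], by linarith [hc.1]⟩)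
      (hS.inter measurableSet_Iic) Set.inter_subset_left
      (fun t ht => recordWeight_one_sub_le h01 (hF ht.2)) hA
  -- Otherwise w(1 - F) ≥ w(1/2) on the whole support, which then has finite length, and w ≤ 1 makes
  -- the second integral finite.
  obtain ⟨c, hc, hc2⟩ : ∃ c ∈ supportInterval F, 1 / 2 < F c := by
    by_contra! hle
    have hw : 0 < recordWeight (1 / 2) := recordWeight_pos ⟨by norm_num, by norm_num⟩
    have hvol : volume (supportInterval F) ≠ ∞ :=
      measure_ne_top_of_setLIntegral_ne_top hw hS subset_rfl
        (fun t ht => monotoneOn_recordWeight ⟨by norm_num, by norm_num⟩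
          ⟨by linarith [(h01 t).2], by linarith [(h01 t).1]⟩ (by linarith [hle t ht])) hA
    refine absurd hB (ne_top_of_le_ne_top (b := 1 * volume (supportInterval F))
      (by rwa [one_mul]) ?_)
    rw [← setLIntegral_const]
    exact lintegral_mono fun t => ENNReal.ofReal_le_one.2 (recordWeight_le_one (h01 t))
  -- Minus `h` is the integrable lower bound: left of c the kernel is at least -1/2, right of c it
  -- is eventually nonnegative.
  set h : ℝ → ℝ := (supportInterval F ∩ Set.Iic c).indicator fun _ => (1 / 2 : ℝ) with hh
  have hh0 : ∀ t, 0 ≤ h t := fun t => Set.indicator_nonneg (fun _ _ => by norm_num) t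
  have hhint : Integrable h := (integrable_indicator_iff (hS.inter measurableSet_Iic)).2
    (integrableOn_const (hbdd c hc))
  simp_rw [← integral_windowKernel]
  refine tendsto_integral_atTop_of_lintegral_eq_top (fun N => integrable_windowKernel _ _) hhint
    ?_ (tendsto_windowKernel_sampleCount hF h01 hx hcount hm hmN) ?_
  · have hlim : Tendsto (fun N => (sampleCount (fun i : Fin N => x i) c : ℝ) / N
        - (m N : ℝ) / N) atTop (𝓝 (F c)) := by simpa using (hcount c).sub hmN
    filter_upwards [hlim.eventually (lt_mem_nhds hc2), eventually_gt_atTop 0] with N h1 h2 t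
    rcases le_or_gt t c with htc | htc
    · have h3 := abs_windowKernel_sampleCount_le hF h01 hx N (m N) t
      have h4 : h t = (supportInterval F).indicator (fun _ => (1 / 2 : ℝ)) t := by
        by_cases ht : t ∈ supportInterval F <;> simp [hh, ht, htc]
      rw [h4]
      linarith [neg_le_of_abs_le h3]
    -- The count is monotone, so the estimate at c serves all t > c simultaneously.
    · refine add_nonneg (windowKernel_nonneg ?_) (hh0 t)
      have hN : (0 : ℝ) < N := by exact_mod_cast h2
      rw [← sub_div, div_lt_div_iff₀ (by norm_num) hN] at h1
      have h3 : N + 2 * m N ≤ 2 * sampleCount (fun i : Fin N => x i) c := by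
        exact_mod_cast (by linarith : (N : ℝ) + 2 * m N ≤ 2 * sampleCount (fun i : Fin N => x i) c)
      have h4 := sampleCount_mono (fun i : Fin N => x i) htc.le
      omega
  · by_contra hne
    -- With g the limit, w(F) = 2g + w(1 - F) ≤ 2(g + h) + w(1 - F) on the support.
    have hle : ∫⁻ t in supportInterval F, ENNReal.ofReal (recordWeight (F t)) ≤
        2 * (∫⁻ t, ENNReal.ofReal ((supportInterval F).indicator
          (fun s => -(1 / 2) * weightDiff (F s)) t + h t)) +
        ∫⁻ t in supportInterval F, ENNReal.ofReal (recordWeight (1 - F t)) := by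
      have m1 : Measurable fun t => ENNReal.ofReal (recordWeight (1 - F t)) :=
        (continuous_recordWeight.measurable.comp
          (measurable_const.sub hF.measurable)).ennreal_ofReal
      rw [← lintegral_const_mul' _ _ (by norm_num)]
      refine le_trans ?_ (add_le_add_left (setLIntegral_le_lintegral (supportInterval F) _) _)
      rw [← lintegral_add_right _ m1]
      refine setLIntegral_mono' hS fun t ht => ?_
      rw [Set.indicator_of_mem ht]
      have e2 : (2 : ℝ≥0∞) = ENNReal.ofReal 2 := by simp
      rw [e2, ← ENNReal.ofReal_mul (by norm_num)]
      refine le_trans (ENNReal.ofReal_le_ofReal ?_) ENNReal.ofReal_add_le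
      unfold weightDiff
      linarith [hh0 t]
    exact absurd hB (ne_top_of_le_ne_top
      (ENNReal.add_ne_top.2 ⟨ENNReal.mul_ne_top (by norm_num) hne, hA⟩) hle)

/-- Mirror image of the previous case: the negated kernel is eventually nonnegative left of a point
c with F(c) < 1/2, and the support right of c has finite length. -/
lemma tendsto_extropyDiffEstimator_atBot (hF : Monotone F) (h01 : ∀ t, F t ∈ Set.Icc (0 : ℝ) 1)
    (hx : ∀ i, x i ∈ supportInterval F)
    (hcount : ∀ t, Tendsto (fun N => (sampleCount (fun i : Fin N => x i) t : ℝ) / N) atTop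
      (𝓝 (F t)))
    (hm : Tendsto m atTop atTop)
    (hmN : Tendsto (fun N : ℕ => (m N : ℝ) / (N : ℝ)) atTop (𝓝 0))
    (hA : ∫⁻ t in supportInterval F, ENNReal.ofReal (recordWeight (1 - F t)) = ∞)
    (hB : ∫⁻ t in supportInterval F, ENNReal.ofReal (recordWeight (F t)) ≠ ∞) :
    Tendsto (fun N => extropyDiffEstimator (fun i : Fin N => x i) (m N)) atTop atBot := by
  have hS := measurableSet_supportInterval hF
  have hbdd : ∀ c ∈ supportInterval F, volume (supportInterval F ∩ Set.Ici c) ≠ ∞ := fun c hc =>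
    measure_ne_top_of_setLIntegral_ne_top (recordWeight_pos hc)
      (hS.inter measurableSet_Ici) Set.inter_subset_left
      (fun t ht => monotoneOn_recordWeight (h01 c) (h01 t) (hF ht.2)) hB
  obtain ⟨c, hc, hc2⟩ : ∃ c ∈ supportInterval F, F c < 1 / 2 := by
    by_contra! hle
    have hw : 0 < recordWeight (1 / 2) := recordWeight_pos ⟨by norm_num, by norm_num⟩
    have hvol : volume (supportInterval F) ≠ ∞ :=
      measure_ne_top_of_setLIntegral_ne_top hw hS subset_rfl
        (fun t ht => monotoneOn_recordWeight ⟨by norm_num, by norm_num⟩ (h01 t) (hle t ht)) hB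
    refine absurd hA (ne_top_of_le_ne_top (b := 1 * volume (supportInterval F))
      (by rwa [one_mul]) ?_)
    rw [← setLIntegral_const]
    exact lintegral_mono fun t => ENNReal.ofReal_le_one.2
      (recordWeight_le_one ⟨by linarith [(h01 t).2], by linarith [(h01 t).1]⟩)
  set h : ℝ → ℝ := (supportInterval F ∩ Set.Ici c).indicator fun _ => (1 / 2 : ℝ) with hh
  have hh0 : ∀ t, 0 ≤ h t := fun t => Set.indicator_nonneg (fun _ _ => by norm_num) t
  have hhint : Integrable h := (integrable_indicator_iff (hS.inter measurableSet_Ici)).2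
    (integrableOn_const (hbdd c hc))
  simp_rw [← integral_windowKernel]
  rw [← tendsto_neg_atTop_iff]
  simp_rw [← integral_neg]
  refine tendsto_integral_atTop_of_lintegral_eq_top
    (fun N => (integrable_windowKernel _ _).neg) hhint ?_
    (fun t => (tendsto_windowKernel_sampleCount hF h01 hx hcount hm hmN t).neg) ?_
  · have hlim : Tendsto (fun N => (sampleCount (fun i : Fin N => x i) c : ℝ) / N
        + (m N : ℝ) / N) atTop (𝓝 (F c)) := by simpa using (hcount c).add hmN
    filter_upwards [hlim.eventually (gt_mem_nhds hc2), eventually_gt_atTop 0] with N h1 h2 t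
    rcases le_or_gt c t with htc | htc
    · have h3 := abs_windowKernel_sampleCount_le hF h01 hx N (m N) t
      have h4 : h t = (supportInterval F).indicator (fun _ => (1 / 2 : ℝ)) t := by
        by_cases ht : t ∈ supportInterval F <;> simp [hh, ht, htc]
      rw [h4]
      linarith [le_of_abs_le h3]
    · refine add_nonneg (neg_nonneg.2 (windowKernel_nonpos ?_)) (hh0 t)
      have hN : (0 : ℝ) < N := by exact_mod_cast h2
      rw [← add_div, div_lt_div_iff₀ hN (by norm_num)] at h1
      have h3 : 2 * sampleCount (fun i : Fin N => x i) c + 2 * m N ≤ N := by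
        exact_mod_cast (by linarith : 2 * (sampleCount (fun i : Fin N => x i) c : ℝ) + 2 * m N ≤ N)
      have h4 := sampleCount_mono (fun i : Fin N => x i) htc.le
      omega
  · by_contra hne
    have hle : ∫⁻ t in supportInterval F, ENNReal.ofReal (recordWeight (1 - F t)) ≤
        2 * (∫⁻ t, ENNReal.ofReal (-(supportInterval F).indicator
          (fun s => -(1 / 2) * weightDiff (F s)) t + h t)) +
        ∫⁻ t in supportInterval F, ENNReal.ofReal (recordWeight (F t)) := by
      have m1 : Measurable fun t => ENNReal.ofReal (recordWeight (F t)) :=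
        (continuous_recordWeight.measurable.comp hF.measurable).ennreal_ofReal
      rw [← lintegral_const_mul' _ _ (by norm_num)]
      refine le_trans ?_ (add_le_add_left (setLIntegral_le_lintegral (supportInterval F) _) _)
      rw [← lintegral_add_right _ m1]
      refine setLIntegral_mono' hS fun t ht => ?_
      rw [Set.indicator_of_mem ht]
      have e2 : (2 : ℝ≥0∞) = ENNReal.ofReal 2 := by simp
      rw [e2, ← ENNReal.ofReal_mul (by norm_num)]
      refine le_trans (ENNReal.ofReal_le_ofReal ?_) ENNReal.ofReal_add_le
      unfold weightDiff
      linarith [hh0 t]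
    exact absurd hA (ne_top_of_le_ne_top
      (ENNReal.add_ne_top.2 ⟨ENNReal.mul_ne_top (by norm_num) hne, hB⟩) hle)

end Deterministic

/-! ### Almost sure behaviour of the sample -/

/-- The jump at t is the mass of {t}, which is zero. -/
lemma continuous_cdf (ν : Measure ℝ) [IsProbabilityMeasure ν] [NullSingletonClass ν] :
    Continuous (cdf ν) := by
  refine continuous_iff_continuousAt.2 fun t => ?_
  have h : (cdf ν).measure {t} = 0 := by rw [measure_cdf]; exact measure_singleton t
  rw [StieltjesFunction.measure_singleton, ENNReal.ofReal_eq_zero] at h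
  have hl : Function.leftLim (cdf ν) t = cdf ν t :=
    le_antisymm ((monotone_cdf ν).leftLim_le le_rfl) (by linarith)
  rw [continuousAt_iff_continuous_left'_right', (monotone_cdf ν).continuousWithinAt_Iio_iff_leftLim_eq]
  exact ⟨hl, ((cdf ν).right_continuous t).mono Set.Ioi_subset_Ici_self⟩

/-- By continuity the level sets of 0 and 1, when nonempty, contain their finite endpoint, beyond
which there is no mass. -/
lemma ae_mem_supportInterval_cdf (ν : Measure ℝ) [IsProbabilityMeasure ν] [NullSingletonClass ν] :
    ∀ᵐ t ∂ν, t ∈ supportInterval (cdf ν) := by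
  have hcont := continuous_cdf ν
  have h0 : ν {t | cdf ν t = 0} = 0 := by
    rcases Set.eq_empty_or_nonempty {t | cdf ν t = 0} with he | hne
    · rw [he, measure_empty]
    have hclosed : IsClosed {t | cdf ν t = 0} := isClosed_eq hcont continuous_const
    obtain ⟨b, hb⟩ := ((tendsto_cdf_atTop ν).eventually (lt_mem_nhds one_pos)).exists
    have hbdd : BddAbove {t | cdf ν t = 0} := ⟨b, fun t ht => by
      by_contra! hlt
      have h1 := monotone_cdf ν hlt.le
      have h2 : cdf ν t = 0 := ht
      linarith⟩
    have hs : cdf ν (sSup {t | cdf ν t = 0}) = 0 := hclosed.csSup_mem hne hbdd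
    rw [cdf_eq_real, measureReal_eq_zero_iff] at hs
    exact measure_mono_null (fun t ht => le_csSup hbdd ht) hs
  have h1 : ν {t | cdf ν t = 1} = 0 := by
    rcases Set.eq_empty_or_nonempty {t | cdf ν t = 1} with he | hne
    · rw [he, measure_empty]
    have hclosed : IsClosed {t | cdf ν t = 1} := isClosed_eq hcont continuous_const
    obtain ⟨b, hb⟩ := ((tendsto_cdf_atBot ν).eventually (gt_mem_nhds one_pos)).exists
    have hbdd : BddBelow {t | cdf ν t = 1} := ⟨b, fun t ht => by
      by_contra! hlt
      have h1 := monotone_cdf ν hlt.le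
      have h2 : cdf ν t = 1 := ht
      linarith⟩
    have hs : cdf ν (sInf {t | cdf ν t = 1}) = 1 := hclosed.csInf_mem hne hbdd
    have hIoi : ν (Set.Ioi (sInf {t | cdf ν t = 1})) = 0 := by
      rw [← Set.compl_Iic, ← measureReal_eq_zero_iff, probReal_compl_eq_one_sub measurableSet_Iic,
        ← cdf_eq_real, hs, sub_self]
    refine measure_mono_null (t := Set.Ici (sInf {t | cdf ν t = 1}))
      (fun t ht => csInf_le hbdd ht) ?_
    -- The endpoint itself is not an atom.
    rw [← Ioi_ae_eq_Ici.measure_eq]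
    exact hIoi
  filter_upwards [measure_eq_zero_iff_ae_notMem.1 h0, measure_eq_zero_iff_ae_notMem.1 h1]
    with t ht0 ht1
  exact ⟨lt_of_le_of_ne (cdf_nonneg ν t) (Ne.symm ht0), lt_of_le_of_ne (cdf_le_one ν t) ht1⟩

/-- Pointwise convergence of distribution functions on the rationals to a continuous limit implies
pointwise convergence everywhere. -/
lemma tendsto_of_tendsto_rat {G : ℕ → ℝ → ℝ} {F : ℝ → ℝ} (hG : ∀ n, Monotone (G n))
    (hF : Continuous F) (h : ∀ q : ℚ, Tendsto (fun n => G n q) atTop (𝓝 (F q))) (t : ℝ) :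
    Tendsto (fun n => G n t) atTop (𝓝 (F t)) := by
  rw [tendsto_order]
  constructor
  · intro a ha
    obtain ⟨l, hl, hlt⟩ := exists_Ioc_subset_of_mem_nhds
      ((hF.continuousAt (x := t)).eventually (lt_mem_nhds ha)) (exists_lt t)
    obtain ⟨q, hq1, hq2⟩ := exists_rat_btwn hl
    filter_upwards [(h q).eventually (lt_mem_nhds (hlt ⟨hq1, hq2.le⟩))] with n hn
    exact hn.trans_le (hG n hq2.le)
  · intro a ha
    obtain ⟨u, hu, hut⟩ := exists_Ico_subset_of_mem_nhds
      ((hF.continuousAt (x := t)).eventually (gt_mem_nhds ha)) (exists_gt t)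
    obtain ⟨q, hq1, hq2⟩ := exists_rat_btwn hu
    filter_upwards [(h q).eventually (gt_mem_nhds (hut ⟨hq1.le, hq2⟩))] with n hn
    exact (hG n hq1.le).trans_lt hn

section Sample

variable {Ω : Type*} [MeasurableSpace Ω] {μ : Measure Ω} [IsProbabilityMeasure μ] {X : ℕ → Ω → ℝ}

/-- Strong law of large numbers for the indicators of X_i ≤ t. -/
lemma ae_tendsto_sampleCount (hindep : iIndepFun X μ)
    (hident : ∀ i, IdentDistrib (X i) (X 0) μ μ) (t : ℝ) :
    ∀ᵐ ω ∂μ, Tendsto (fun N => (sampleCount (fun i : Fin N => X i ω) t : ℝ) / N) atTop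
      (𝓝 (cdf (μ.map (X 0)) t)) := by
  have hX := (hident 0).aemeasurable_fst
  have := Measure.isProbabilityMeasure_map hX
  set u : ℝ → ℝ := (Set.Iic t).indicator fun _ => (1 : ℝ) with hu
  have hum : Measurable u := measurable_const.indicator measurableSet_Iic
  have hint : ∫ ω, u (X 0 ω) ∂μ = cdf (μ.map (X 0)) t := by
    rw [← integral_map hX hum.aestronglyMeasurable, hu, integral_indicator measurableSet_Iic,
      setIntegral_const, cdf_eq_real]
    simp
  have hbound : ∀ s, ‖u s‖ ≤ 1 := fun s => by
    by_cases hs : s ≤ t <;> simp [hu, hs]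
  have hslln := strong_law_ae_real (μ := μ) (fun i => u ∘ X i)
    (Integrable.of_bound (hum.comp_aemeasurable hX).aestronglyMeasurable 1
      (Eventually.of_forall fun ω => hbound _))
    (fun i j hij => (hindep.indepFun hij).comp hum hum) (fun i => (hident i).comp hum)
  filter_upwards [hslln] with ω hω
  simp only [Function.comp_apply, hint] at hω
  refine hω.congr fun N => ?_
  rw [sampleCount_eq_sum_indicator, Finset.sum_range]

/-- The null set depends on t, so only rational t are used; monotonicity and continuity of F give
the rest. -/
lemma ae_forall_tendsto_sampleCount (hindep : iIndepFun X μ)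
    (hident : ∀ i, IdentDistrib (X i) (X 0) μ μ) (hF : Continuous (cdf (μ.map (X 0)))) :
    ∀ᵐ ω ∂μ, ∀ t, Tendsto (fun N => (sampleCount (fun i : Fin N => X i ω) t : ℝ) / N) atTop
      (𝓝 (cdf (μ.map (X 0)) t)) := by
  filter_upwards [ae_all_iff.2 fun q : ℚ => ae_tendsto_sampleCount hindep hident (q : ℝ)] with ω hω
  refine tendsto_of_tendsto_rat (fun N s t hst => ?_) hF hω
  have : (sampleCount (fun i : Fin N => X i ω) s : ℝ) ≤ sampleCount (fun i : Fin N => X i ω) t := by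
    exact_mod_cast sampleCount_mono _ hst
  gcongr

lemma ae_forall_mem_supportInterval (hident : ∀ i, IdentDistrib (X i) (X 0) μ μ)
    [NullSingletonClass (μ.map (X 0))] :
    ∀ᵐ ω ∂μ, ∀ i, X i ω ∈ supportInterval (cdf (μ.map (X 0))) := by
  have := Measure.isProbabilityMeasure_map (hident 0).aemeasurable_fst
  refine ae_all_iff.2 fun i => ?_
  have h := ae_mem_supportInterval_cdf (μ.map (X 0))
  rw [← (hident i).map_eq] at h
  exact ae_of_ae_map (hident i).aemeasurable_fst (by
    filter_upwards [h] with t ht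
    rwa [(hident i).map_eq] at ht)

end Sample

/-- If a sequence of random variables lies almost surely eventually outside some sets, then the
probabilities of these sets tend to `0`. -/
lemma tendsto_measure_zero_of_ae_eventually_notMem {Ω : Type*} [MeasurableSpace Ω] {μ : Measure Ω}
    [IsFiniteMeasure μ] {A : ℕ → Set Ω} (hA : ∀ n, NullMeasurableSet (A n) μ)
    (h : ∀ᵐ ω ∂μ, ∀ᶠ n in atTop, ω ∉ A n) : Tendsto (fun n => μ (A n)) atTop (𝓝 0) := by
  -- The sets are only null-measurable, hence the passage to measurable hulls.
  have := tendsto_measure_of_ae_tendsto_indicator_of_isFiniteMeasure (μ := μ) (L := atTop)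
    MeasurableSet.empty (As := fun n => toMeasurable μ (A n))
    (fun n => measurableSet_toMeasurable μ (A n)) ?_
  · simpa using this
  · have he : ∀ᵐ ω ∂μ, ∀ n, ω ∈ toMeasurable μ (A n) ↔ ω ∈ A n :=
      ae_all_iff.2 fun n => (hA n).toMeasurable_ae_eq.mem_iff
    filter_upwards [h, he] with ω h1 h2
    filter_upwards [h1] with n hn
    simp [h2, hn]

theorem mainTheorem7 {Ω : Type*} [MeasurableSpace Ω] (μ : Measure Ω) [IsProbabilityMeasure μ]
    (X : ℕ → Ω → ℝ)
    (hindep : iIndepFun X μ)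
    (hident : ∀ i, IdentDistrib (X i) (X 0) μ μ)
    (hpdf : HasPDF (X 0) μ volume)
    (hvar : MemLp (X 0) 2 μ)
    (F : ℝ → ℝ) (hF : ∀ x, F x = cdf (μ.map (X 0)) x)
    (hdef : ¬ (cumResidualExtropy (upperRecordCDF 2 2 F) = ⊥ ∧
      cumPastExtropy (lowerRecordCDF 2 2 F) = ⊥))
    (m : ℕ → ℕ) (hm : Tendsto m atTop atTop)
    (hmN : Tendsto (fun N : ℕ => (m N : ℝ) / (N : ℝ)) atTop (𝓝 0)) :
    (∀ δ : ℝ, recordExtropyDiff 2 2 F = (δ : EReal) →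
      TendstoInMeasure μ
        (fun N ω => extropyDiffEstimator (fun i : Fin N => X i ω) (m N)) atTop (fun _ => δ)) ∧
    (recordExtropyDiff 2 2 F = ⊤ → ∀ M : ℝ,
      Tendsto (fun N => μ {ω | extropyDiffEstimator (fun i : Fin N => X i ω) (m N) ≤ M})
        atTop (𝓝 0)) ∧
    (recordExtropyDiff 2 2 F = ⊥ → ∀ M : ℝ,
      Tendsto (fun N => μ {ω | M ≤ extropyDiffEstimator (fun i : Fin N => X i ω) (m N)})
        atTop (𝓝 0)) := by
  have hX : ∀ i, AEMeasurable (X i) μ := fun i => (hident i).aemeasurable_fst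
  have := Measure.isProbabilityMeasure_map (hX 0)
  have : NullSingletonClass (μ.map (X 0)) :=
    ⟨fun t => HasPDF.absolutelyContinuous (μ := volume) (measure_singleton t)⟩
  obtain rfl : F = ⇑(cdf (μ.map (X 0))) := funext hF
  set F : ℝ → ℝ := ⇑(cdf (μ.map (X 0)))
  have hmono : Monotone F := monotone_cdf _
  have h01 : ∀ t, F t ∈ Set.Icc (0 : ℝ) 1 := fun t => ⟨cdf_nonneg _ t, cdf_le_one _ t⟩
  have hmeas : ∀ N, AEMeasurable
      (fun ω => extropyDiffEstimator (fun i : Fin N => X i ω) (m N)) μ := fun N =>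
    (measurable_extropyDiffEstimator N (m N)).comp_aemeasurable
      (aemeasurable_pi_lambda _ fun i => hX i)
  have hae : ∀ᵐ ω ∂μ, (∀ i, X i ω ∈ supportInterval F) ∧ ∀ t,
      Tendsto (fun N => (sampleCount (fun i : Fin N => X i ω) t : ℝ) / N) atTop (𝓝 (F t)) :=
    (ae_forall_mem_supportInterval hident).and
      (ae_forall_tendsto_sampleCount hindep hident (continuous_cdf _))
  rw [recordExtropyDiff, cumResidualExtropy_upperRecordCDF h01, cumPastExtropy_lowerRecordCDF h01]
  rw [cumResidualExtropy_upperRecordCDF h01, cumPastExtropy_lowerRecordCDF h01] at hdef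
  set A := ∫⁻ t in supportInterval F, ENNReal.ofReal (recordWeight (1 - F t)) with hA
  set B := ∫⁻ t in supportInterval F, ENNReal.ofReal (recordWeight (F t)) with hB
  have half_top : (1 / 2 : ℝ≥0∞) * ∞ = ∞ := ENNReal.mul_top (by norm_num)
  have half_coe : ∀ C : ℝ≥0∞, C ≠ ∞ →
      (((1 / 2 : ℝ≥0∞) * C : ℝ≥0∞) : EReal) = ((C.toReal / 2 : ℝ) : EReal) := fun C hC => by
    rw [← ENNReal.ofReal_toReal (ENNReal.mul_ne_top (by norm_num) hC), EReal.coe_ennreal_ofReal,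
      max_eq_left ENNReal.toReal_nonneg, ENNReal.toReal_mul]
    congr 1
    simp
    ring
  by_cases hAt : A = ∞
  -- Well-definedness of the difference excludes A = B = ∞.
  · have hBt : B ≠ ∞ := fun h => hdef (by rw [hAt, h, half_top]; simp)
    have hD : -(((1 / 2 : ℝ≥0∞) * A : ℝ≥0∞) : EReal) - -(((1 / 2 : ℝ≥0∞) * B : ℝ≥0∞) : EReal)
        = ⊥ := by
      rw [hAt, half_top, half_coe B hBt]; simp
    rw [hD]
    refine ⟨fun δ h => absurd h (EReal.bot_ne_coe δ), fun h => absurd h bot_ne_top, fun _ M => ?_⟩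
    refine tendsto_measure_zero_of_ae_eventually_notMem
      (fun N => nullMeasurableSet_le aemeasurable_const (hmeas N)) ?_
    filter_upwards [hae] with ω hω
    filter_upwards [(tendsto_extropyDiffEstimator_atBot hmono h01 hω.1 hω.2 hm hmN hAt
      hBt).eventually_lt_atBot M] with N hN
    exact not_le.2 hN
  by_cases hBt : B = ∞
  · have hD : -(((1 / 2 : ℝ≥0∞) * A : ℝ≥0∞) : EReal) - -(((1 / 2 : ℝ≥0∞) * B : ℝ≥0∞) : EReal)
        = ⊤ := by
      rw [hBt, half_top, half_coe A hAt, ← EReal.coe_neg]; simp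
    rw [hD]
    refine ⟨fun δ h => absurd h (EReal.top_ne_coe δ), fun _ M => ?_, fun h => absurd h top_ne_bot⟩
    refine tendsto_measure_zero_of_ae_eventually_notMem
      (fun N => nullMeasurableSet_le (hmeas N) aemeasurable_const) ?_
    filter_upwards [hae] with ω hω
    filter_upwards [(tendsto_extropyDiffEstimator_atTop hmono h01 hω.1 hω.2 hm hmN hAt
      hBt).eventually_gt_atTop M] with N hN
    exact not_le.2 hN
  · have hD : -(((1 / 2 : ℝ≥0∞) * A : ℝ≥0∞) : EReal) - -(((1 / 2 : ℝ≥0∞) * B : ℝ≥0∞) : EReal)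
        = (((B.toReal - A.toReal) / 2 : ℝ) : EReal) := by
      rw [half_coe A hAt, half_coe B hBt, ← EReal.coe_neg, ← EReal.coe_neg, ← EReal.coe_sub]
      congr 1
      ring
    rw [hD]
    refine ⟨fun δ h => ?_, fun h => absurd h (EReal.coe_ne_top _),
      fun h => absurd h (EReal.coe_ne_bot _)⟩
    rw [← EReal.coe_eq_coe_iff.1 h]
    refine tendstoInMeasure_of_tendsto_ae (fun N => (hmeas N).aestronglyMeasurable) ?_
    filter_upwards [hae] with ω hω
    have hlim := tendsto_extropyDiffEstimator hmono h01 hω.1 hω.2 hm hmN hAt hBt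
    exact hlim
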